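/- Let $L^\infty(\mathbb{R})$ be the space of (classes of) complex-valued essentially bounded measurable functions on $\mathbb{R}$. A mean on $L^\infty(\mathbb{R})$ is a bounded linear functional $\Phi\in L^\infty(\mathbb{R})^*$ with $\Phi(\phi)\ge 0$ whenever $\phi\ge 0$ and $\Phi(1)=1$. It is topologically invariant if $\Phi(f*\phi)=\Phi(\phi)$ for every $\phi\in L^\infty(\mathbb{R})$ and every $f\in L^1(\mathbb{R})$ with $f\ge 0$ and $\int_{\mathbb{R}} f(x)\,dx=1$, where $(f*\phi)(x)=\int_{\mathbb{R}}\phi(x-t)f(t)\,dt$. A function $\phi\in L^\infty(\mathbb{R})$ almost converges to $\alpha\in\mathbb{C}$ if $\Phi(\phi)=\alpha$ for every topologically invariant mean $\Phi$ on $L^\infty(\mathbb{R})$. Let $H^\infty(\mathbb{R})\subseteq L^\infty(\mathbb{R})$ be the set of boundary functions $\phi(y)=\lim_{x\to 0^+}F(x+iy)$ (for almost every $y\in\mathbb{R}$) of bounded analytic functions $F$ on the right half plane $\{z\in\mathbb{C}:\operatorname{Re} z>0\}$. Corollary 4.1. Almost convergence is multiplicative on $H^\infty(\mathbb{R})$: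 if $\phi,\psi\in H^\infty(\mathbb{R})$ almost converge to $\alpha,\beta\in\mathbb{C}$ respectively, then $\phi\psi$ almost converges to $\alpha\beta$. -/

import Mathlib

open MeasureTheory Filter Topology
open scoped ENNReal ComplexOrder Convolution

noncomputable section

/-- `L^∞(ℝ)`: essentially bounded complex-valued functions on the line, modulo null sets. -/
abbrev LInf : Type := Lp ℂ ∞ (volume : Measure ℝ)

/-- `P(ℝ)`: the integrable `f ≥ 0` (a.e.) on the line with `∫ f = 1`. -/
def IsProbDensity (f : ℝ → ℝ) : Prop :=
  Integrable f ∧ (∀ᵐ x, 0 ≤ f x) ∧ ∫ x, f x = 1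

/-- The convolution `x ↦ ∫ f(t) φ(x - t) dt` of an integrable function with an essentially
bounded one is essentially bounded. -/
theorem memLp_top_convolution {f : ℝ → ℝ} (hf : Integrable f) (φ : LInf) :
    MemLp (f ⋆[ContinuousLinearMap.lsmul ℝ ℝ, volume] (φ : ℝ → ℂ)) ∞ volume := by
  have hbd : ∀ᵐ t : ℝ, ‖φ t‖ ≤ ‖φ‖ := by
    have h := ae_le_eLpNormEssSup (f := (φ : ℝ → ℂ)) (μ := volume)
    filter_upwards [h] with t ht
    rw [Lp.norm_def, eLpNorm_exponent_top]
    have hfin : eLpNormEssSup (φ : ℝ → ℂ) volume ≠ ∞ := by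
      have := Lp.eLpNorm_ne_top φ
      rwa [eLpNorm_exponent_top] at this
    rw [← toReal_enorm]
    exact ENNReal.toReal_mono hfin ht
  refine memLp_top_of_bound ?_ ((∫ t, ‖f t‖) * ‖φ‖) (Eventually.of_forall fun x => ?_)
  · exact (AEStronglyMeasurable.convolution_integrand (ContinuousLinearMap.lsmul ℝ ℝ)
      hf.aestronglyMeasurable (Lp.aestronglyMeasurable φ)).integral_prod_right'
  · rw [convolution_def, ← integral_mul_const]
    refine norm_integral_le_of_norm_le (hf.norm.mul_const _) ?_
    have hx := (Measure.measurePreserving_sub_left (volume : Measure ℝ) x).quasiMeasurePreserving.ae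
      hbd
    filter_upwards [hx] with t ht
    rw [ContinuousLinearMap.lsmul_apply, norm_smul]
    gcongr

/-- The convolution `(f * φ)(x) = ∫ φ(x - t) f(t) dt` as an element of `L^∞(ℝ)`. -/
def convLInf (f : ℝ → ℝ) (hf : Integrable f) (φ : LInf) : LInf :=
  (memLp_top_convolution hf φ).toLp (f ⋆[ContinuousLinearMap.lsmul ℝ ℝ, volume] (φ : ℝ → ℂ))

/-- The constant function `1` as an element of `L^∞(ℝ)`. -/
def oneLInf : LInf := (memLp_top_const (1 : ℂ)).toLp (fun _ : ℝ => (1 : ℂ))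

/-- A mean on `L^∞(ℝ)`: a bounded complex-linear functional that is positive and normalized.
In the order of `ℂ`, `0 ≤ z` says that `z` is a nonnegative real number. -/
def IsMean (Φ : StrongDual ℂ LInf) : Prop :=
  (∀ φ : LInf, (∀ᵐ x : ℝ, 0 ≤ φ x) → 0 ≤ Φ φ) ∧ Φ oneLInf = 1

/-- A topologically invariant mean: `Φ(f * φ) = Φ(φ)` for all `f ∈ P(ℝ)`, `φ ∈ L^∞(ℝ)`. -/
def IsTopInvariantMean (Φ : StrongDual ℂ LInf) : Prop :=
  IsMean Φ ∧ ∀ (f : ℝ → ℝ) (hf : IsProbDensity f) (φ : LInf), Φ (convLInf f hf.1 φ) = Φ φ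

/-- `φ` is almost convergent to `α`: every topologically invariant mean takes the value `α`
at `φ`. -/
def AlmostConvergesTo (φ : LInf) (α : ℂ) : Prop :=
  ∀ Φ : StrongDual ℂ LInf, IsTopInvariantMean Φ → Φ φ = α

/-- The Hardy class `H^∞` of the right half plane: `F` is analytic and bounded on `Re z > 0`
(its values elsewhere are irrelevant). -/
def IsHardyInf (F : ℂ → ℂ) : Prop :=
  DifferentiableOn ℂ F {z : ℂ | 0 < z.re} ∧ ∃ C : ℝ, ∀ z : ℂ, 0 < z.re → ‖F z‖ ≤ C

/-- `H^∞(ℝ) ⊆ L^∞(ℝ)`: the boundary functions `φ(y) = lim_{x → 0+} F(x + iy)` (for almost every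
`y`) of the functions `F` in `H^∞` of the right half plane. -/
def HInfBoundary : Set LInf :=
  {φ | ∃ F : ℂ → ℂ, IsHardyInf F ∧
    ∀ᵐ y : ℝ, Tendsto (fun x : ℝ => F ((x : ℂ) + (y : ℂ) * Complex.I)) (𝓝[>] 0) (𝓝 (φ y))}

/-- The pointwise (a.e.) product of two elements of `L^∞(ℝ)`. -/
def mulLInf (φ ψ : LInf) : LInf :=
  ((Lp.memLp ψ).mul (Lp.memLp φ) : MemLp ((φ : ℝ → ℂ) * (ψ : ℝ → ℂ)) ∞ volume).toLp
    ((φ : ℝ → ℂ) * (ψ : ℝ → ℂ))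

end

/-! The key is a criterion in terms of the Poisson extension: `φ` almost converges to `α` exactly
when its Poisson integrals at `x + iy` tend to `α` uniformly in `y` as `x → ∞`. For boundary
functions of `F` and `G` in `H^∞` the Poisson integrals are the values of `F` and `G`
(`IsHardyInf.poissonIntegral_eq`), so the Poisson extension is multiplicative there, and uniform
convergence to constants passes to products.

One half of the criterion (`IsTopInvariantMean.eq_of_tendsto_poissonIntegral`) holds because the
Poisson kernel is a probability density: an invariant mean does not see convolution with it. For the
other half (`AlmostConvergesTo.tendsto_poissonIntegral`), suppose uniformity fails along points `x n
+ i y n` with `x n → ∞`. Evaluations of the Poisson extension there are means, and a vertical shift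
by `t` changes them by at most `|t| ‖φ‖ / x n`. An ultrafilter limit is thus a topologically
invariant mean whose value at `φ` is not `α`. -/

/-- The Poisson kernel `s ↦ x / (π (s² + x²))` of the right half plane. -/
noncomputable def halfPlanePoisson (x s : ℝ) : ℝ := Real.pi⁻¹ * (x / (s ^ 2 + x ^ 2))

theorem halfPlanePoisson_eq_cauchyPDFReal {x : ℝ} (hx : 0 < x) :
    halfPlanePoisson x = ProbabilityTheory.cauchyPDFReal 0 x.toNNReal := by
  ext s
  simp [halfPlanePoisson, ProbabilityTheory.cauchyPDFReal_def, hx.le, div_eq_mul_inv, mul_assoc]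

theorem halfPlanePoisson_nonneg {x : ℝ} (hx : 0 < x) (s : ℝ) : 0 ≤ halfPlanePoisson x s := by
  unfold halfPlanePoisson; positivity

theorem integrable_halfPlanePoisson {x : ℝ} (hx : 0 < x) : Integrable (halfPlanePoisson x) := by
  rw [halfPlanePoisson_eq_cauchyPDFReal hx]
  exact ProbabilityTheory.integrable_cauchyPDFReal 0

theorem integral_halfPlanePoisson {x : ℝ} (hx : 0 < x) : ∫ s, halfPlanePoisson x s = 1 := by
  rw [halfPlanePoisson_eq_cauchyPDFReal hx]
  exact ProbabilityTheory.integral_cauchyPDFReal_eq_one 0 (by simpa using hx)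

theorem isProbDensity_halfPlanePoisson {x : ℝ} (hx : 0 < x) :
    IsProbDensity (halfPlanePoisson x) :=
  ⟨integrable_halfPlanePoisson hx, Eventually.of_forall (halfPlanePoisson_nonneg hx),
    integral_halfPlanePoisson hx⟩

theorem continuous_halfPlanePoisson {x : ℝ} (hx : 0 < x) : Continuous (halfPlanePoisson x) := by
  unfold halfPlanePoisson
  refine continuous_const.mul (continuous_const.div (by fun_prop) fun s => by positivity)

/-- Over a common denominator this is `2x|s + u| ≤ s² + u² + 2x²`. Having kernels on the right makes
the bound integrable, with total mass `|s - u| / x` after translation. -/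
theorem abs_halfPlanePoisson_sub_le {x : ℝ} (hx : 0 < x) (s u : ℝ) :
    |halfPlanePoisson x s - halfPlanePoisson x u| ≤
      |s - u| / (2 * x) * (halfPlanePoisson x s + halfPlanePoisson x u) := by
  have hs : 0 < s ^ 2 + x ^ 2 := by positivity
  have hu : 0 < u ^ 2 + x ^ 2 := by positivity
  have hpi := Real.pi_pos
  have e1 : halfPlanePoisson x s - halfPlanePoisson x u =
      (s - u) * (-(s + u)) * (Real.pi⁻¹ * x / ((s ^ 2 + x ^ 2) * (u ^ 2 + x ^ 2))) := by
    unfold halfPlanePoisson; field_simp; ring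
  have e2 : |s - u| / (2 * x) * (halfPlanePoisson x s + halfPlanePoisson x u) =
      |s - u| * ((s ^ 2 + u ^ 2 + 2 * x ^ 2) / (2 * x)) *
        (Real.pi⁻¹ * x / ((s ^ 2 + x ^ 2) * (u ^ 2 + x ^ 2))) := by
    unfold halfPlanePoisson; field_simp; ring
  rw [e1, e2, abs_mul, abs_mul, abs_of_nonneg (a := Real.pi⁻¹ * x / _) (by positivity)]
  gcongr
  rw [abs_neg, le_div_iff₀ (by positivity), ← abs_of_pos (show 0 < 2 * x by positivity), ← abs_mul, abs_le]
  constructor <;> nlinarith [sq_nonneg (s - x), sq_nonneg (s + x), sq_nonneg (u - x), sq_nonneg (u + x)]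

/-! ### Poisson integrals of bounded functions -/

/-- The Poisson integral of `g` at the point `x + iy`. -/
noncomputable def poissonIntegral (x y : ℝ) (g : ℝ → ℂ) : ℂ :=
  ∫ s, (halfPlanePoisson x (y - s) : ℂ) * g s

theorem integrable_halfPlanePoisson_sub_mul {x : ℝ} (hx : 0 < x) (y : ℝ) {g : ℝ → ℂ} {C : ℝ}
    (hg : AEStronglyMeasurable g) (hC : ∀ᵐ s, ‖g s‖ ≤ C) :
    Integrable fun s => (halfPlanePoisson x (y - s) : ℂ) * g s :=
  ((integrable_halfPlanePoisson hx).comp_sub_left y).ofReal.mul_bdd hg hC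

theorem norm_poissonIntegral_le {x : ℝ} (hx : 0 < x) (y : ℝ) {g : ℝ → ℂ} {C : ℝ}
    (hC : ∀ᵐ s, ‖g s‖ ≤ C) : ‖poissonIntegral x y g‖ ≤ C := by
  have h : ∫ s, halfPlanePoisson x (y - s) * C = C := by
    rw [integral_mul_const, integral_sub_left_eq_self (halfPlanePoisson x),
      integral_halfPlanePoisson hx, one_mul]
  rw [← h]
  refine norm_integral_le_of_norm_le
    (((integrable_halfPlanePoisson hx).comp_sub_left y).mul_const C) ?_
  filter_upwards [hC] with s hs
  rw [norm_mul, Complex.norm_real, Real.norm_of_nonneg (halfPlanePoisson_nonneg hx _)]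
  exact mul_le_mul_of_nonneg_left hs (halfPlanePoisson_nonneg hx _)

theorem poissonIntegral_const {x : ℝ} (hx : 0 < x) (y : ℝ) (c : ℂ) :
    poissonIntegral x y (fun _ => c) = c := by
  rw [poissonIntegral, integral_mul_const, integral_complex_ofReal,
    integral_sub_left_eq_self (halfPlanePoisson x), integral_halfPlanePoisson hx]
  simp

theorem norm_poissonIntegral_sub_le {x : ℝ} (hx : 0 < x) (y z : ℝ) {g : ℝ → ℂ} {C : ℝ}
    (hg : AEStronglyMeasurable g) (hC : ∀ᵐ s, ‖g s‖ ≤ C) :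
    ‖poissonIntegral x y g - poissonIntegral x z g‖ ≤ |y - z| / x * C := by
  have h : ∫ s, |y - z| / (2 * x) * (halfPlanePoisson x (y - s) + halfPlanePoisson x (z - s)) * C
      = |y - z| / x * C := by
    rw [integral_mul_const, integral_const_mul,
      integral_add ((integrable_halfPlanePoisson hx).comp_sub_left y)
        ((integrable_halfPlanePoisson hx).comp_sub_left z),
      integral_sub_left_eq_self (halfPlanePoisson x),
      integral_sub_left_eq_self (halfPlanePoisson x), integral_halfPlanePoisson hx]
    field_simp
    ring
  rw [← h, poissonIntegral, poissonIntegral, ← integral_sub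
    (integrable_halfPlanePoisson_sub_mul hx y hg hC)
    (integrable_halfPlanePoisson_sub_mul hx z hg hC)]
  refine norm_integral_le_of_norm_le
    (((((integrable_halfPlanePoisson hx).comp_sub_left y).add
      ((integrable_halfPlanePoisson hx).comp_sub_left z)).const_mul _).mul_const C) ?_
  filter_upwards [hC] with s hs
  rw [← sub_mul, norm_mul, ← Complex.ofReal_sub, Complex.norm_real, Real.norm_eq_abs]
  have h1 := abs_halfPlanePoisson_sub_le hx (y - s) (z - s)
  rw [sub_sub_sub_cancel_right] at h1
  exact mul_le_mul h1 hs (norm_nonneg _) ((abs_nonneg _).trans h1)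

theorem poissonIntegral_convolution {x : ℝ} (hx : 0 < x) (y : ℝ) {f : ℝ → ℝ} (hf : Integrable f)
    {g : ℝ → ℂ} {C : ℝ} (hg : AEStronglyMeasurable g) (hC : ∀ᵐ s, ‖g s‖ ≤ C) :
    poissonIntegral x y (f ⋆[ContinuousLinearMap.lsmul ℝ ℝ, volume] g) =
      ∫ t, (f t : ℂ) * poissonIntegral x (y - t) g := by
  have hsub : Measure.QuasiMeasurePreserving (fun p : ℝ × ℝ => p.1 - p.2)
      (volume.prod volume) volume := quasiMeasurePreserving_sub volume volume
  have hint : Integrable (Function.uncurry fun s t : ℝ =>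
      (halfPlanePoisson x (y - s) : ℂ) * (f t : ℂ) * g (s - t)) (volume.prod volume) :=
    ((((integrable_halfPlanePoisson hx).comp_sub_left y).ofReal (𝕜 := ℂ)).mul_prod
      (hf.ofReal (𝕜 := ℂ))).mul_bdd (hg.comp_quasiMeasurePreserving hsub) (hsub.ae hC)
  calc poissonIntegral x y (f ⋆[ContinuousLinearMap.lsmul ℝ ℝ, volume] g)
      = ∫ s, ∫ t, (halfPlanePoisson x (y - s) : ℂ) * (f t : ℂ) * g (s - t) := by
        simp only [poissonIntegral, convolution_def, ContinuousLinearMap.lsmul_apply,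
          Complex.real_smul, ← integral_const_mul, mul_assoc]
    _ = ∫ t, ∫ s, (halfPlanePoisson x (y - s) : ℂ) * (f t : ℂ) * g (s - t) :=
        integral_integral_swap hint
    _ = _ := by
        refine integral_congr_ae (Eventually.of_forall fun t => ?_)
        simp only [poissonIntegral, ← integral_const_mul]
        -- Translating `s` by `t` moves the shift from `g` to the base point of the kernel.
        rw [← integral_sub_right_eq_self
          (fun s => (f t : ℂ) * ((halfPlanePoisson x (y - t - s) : ℂ) * g s)) t]
        refine integral_congr_ae (Eventually.of_forall fun s => ?_)
        simp only [sub_sub_sub_cancel_right]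
        ring

/-! ### The Poisson formula in the right half plane -/

/-- A point of the closed half plane is no farther from `w₀` than from its reflection `-conj w₀`, so
both factors of the denominator have norm at least `R`. -/
theorem norm_dslope_div_le {G : ℂ → ℂ} {C : ℝ} (hC : ∀ z : ℂ, 0 ≤ z.re → ‖G z‖ ≤ C)
    {w₀ w : ℂ} (hw₀ : 0 < w₀.re) (hw : 0 ≤ w.re) {R : ℝ} (hR : 0 < R) (hRw : R ≤ ‖w - w₀‖) :
    ‖dslope G w₀ w / (w + (starRingEnd ℂ) w₀)‖ ≤ 2 * C / R ^ 2 := by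
  have hne : w ≠ w₀ := by rintro rfl; simp at hRw; linarith
  have hle : ‖w - w₀‖ ≤ ‖w + (starRingEnd ℂ) w₀‖ := by
    rw [← sq_le_sq₀ (norm_nonneg _) (norm_nonneg _), ← Complex.normSq_eq_norm_sq,
      ← Complex.normSq_eq_norm_sq, Complex.normSq_apply, Complex.normSq_apply]
    simp only [Complex.sub_re, Complex.sub_im, Complex.add_re, Complex.add_im, Complex.conj_re,
      Complex.conj_im]
    nlinarith [mul_nonneg hw hw₀.le]
  have hC0 : 0 ≤ C := (norm_nonneg _).trans (hC w hw)
  rw [dslope_of_ne _ hne, slope_def_field, norm_div, norm_div, div_div, sq]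
  gcongr
  · calc ‖G w - G w₀‖ ≤ ‖G w‖ + ‖G w₀‖ := norm_sub_le _ _
      _ ≤ 2 * C := by linarith [hC w hw, hC w₀ hw₀.le]
  · exact hRw.trans hle

/-- Cauchy's theorem on the rectangle `[0, R + x] × [y - R, y + R]`, in the form of a bound for
the part of the boundary integral along the imaginary axis. -/
theorem norm_intervalIntegral_dslope_div_le {G : ℂ → ℂ} (hG : DifferentiableOn ℂ G {z | 0 ≤ z.re})
    {C : ℝ} (hC : ∀ z : ℂ, 0 ≤ z.re → ‖G z‖ ≤ C) {w₀ : ℂ} (hw₀ : 0 < w₀.re) {R : ℝ} (hR : 0 < R) :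
    ‖∫ t : ℝ in (w₀.im - R)..(w₀.im + R),
      dslope G w₀ (t * Complex.I) / (t * Complex.I + (starRingEnd ℂ) w₀)‖ ≤
        2 * C / R ^ 2 * (4 * R + 2 * w₀.re) := by
  have hd : DifferentiableOn ℂ (fun w => dslope G w₀ w / (w + (starRingEnd ℂ) w₀))
      {z | 0 ≤ z.re} := by
    -- Since `w₀` is interior, the singularity of the difference quotient there is removable.
    have hmem : {z : ℂ | 0 ≤ z.re} ∈ 𝓝 w₀ :=
      mem_of_superset ((isOpen_lt continuous_const Complex.continuous_re).mem_nhds hw₀)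
        fun z (hz : 0 < z.re) => hz.le
    refine ((Complex.differentiableOn_dslope hmem).2 hG).div
      (differentiableOn_id.add_const _) fun z hz h0 => ?_
    have := congrArg Complex.re h0
    simp only [Complex.add_re, Complex.conj_re, Complex.zero_re] at this
    have hz' : 0 ≤ z.re := hz
    linarith
  set H : ℂ → ℂ := fun w => dslope G w₀ w / (w + (starRingEnd ℂ) w₀) with hH
  -- The three sides off the imaginary axis lie at distance at least `R` from `w₀` and have total
  -- length `4R + 2 w₀.re`.
  have key := Complex.integral_boundary_rect_eq_zero_of_differentiableOn H
    ⟨0, w₀.im - R⟩ ⟨R + w₀.re, w₀.im + R⟩ (hd.mono (by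
      rintro z ⟨hz, -⟩
      have hz' : z.re ∈ Set.uIcc 0 (R + w₀.re) := hz
      rw [Set.uIcc_of_le (by linarith)] at hz'
      exact hz'.1))
  simp only [Complex.ofReal_zero, zero_add] at key
  have hI : ∀ t ∈ Set.uIoc (0 : ℝ) (R + w₀.re), 0 ≤ t := fun t ht => by
    rw [Set.uIoc_of_le (by linarith)] at ht; exact ht.1.le
  have b1 : ‖∫ t : ℝ in (0 : ℝ)..(R + w₀.re), H (t + (w₀.im - R : ℝ) * Complex.I)‖ ≤
      2 * C / R ^ 2 * |R + w₀.re - 0| := by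
    refine intervalIntegral.norm_integral_le_of_norm_le_const fun t ht =>
      norm_dslope_div_le hC hw₀ (by simpa using hI t ht) hR ?_
    refine le_trans ?_ (Complex.abs_im_le_norm _)
    simp [abs_of_pos hR]
  have b2 : ‖∫ t : ℝ in (0 : ℝ)..(R + w₀.re), H (t + (w₀.im + R : ℝ) * Complex.I)‖ ≤
      2 * C / R ^ 2 * |R + w₀.re - 0| := by
    refine intervalIntegral.norm_integral_le_of_norm_le_const fun t ht =>
      norm_dslope_div_le hC hw₀ (by simpa using hI t ht) hR ?_
    refine le_trans ?_ (Complex.abs_im_le_norm _)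
    simp [abs_of_pos hR]
  have b3 : ‖∫ t : ℝ in (w₀.im - R)..(w₀.im + R), H ((R + w₀.re : ℝ) + t * Complex.I)‖ ≤
      2 * C / R ^ 2 * |w₀.im + R - (w₀.im - R)| := by
    refine intervalIntegral.norm_integral_le_of_norm_le_const fun t ht =>
      norm_dslope_div_le hC hw₀ (by simpa using by linarith) hR ?_
    refine le_trans ?_ (Complex.abs_re_le_norm _)
    simp [abs_of_pos hR]
  rw [sub_eq_zero] at key
  have hn := congrArg norm key
  rw [norm_smul (x := ∫ t : ℝ in (w₀.im - R)..(w₀.im + R), H (t * Complex.I)), Complex.norm_I,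
    one_mul] at hn
  rw [← hn]
  rw [← one_mul ‖∫ t : ℝ in _.._, H ((R + w₀.re : ℝ) + t * Complex.I)‖, ← Complex.norm_I,
    ← norm_smul] at b3
  refine (norm_add_le _ _).trans
    ((add_le_add ((norm_sub_le _ _).trans (add_le_add b1 b2)) b3).trans_eq ?_)
  rw [abs_of_pos (by linarith), abs_of_pos (by linarith)]
  ring

/-- On the imaginary axis `(w - w₀)(w + conj w₀) = -((y - t)² + x²)`, which turns the Cauchy
integrand into the Poisson integrand. -/
theorem dslope_div_eq_halfPlanePoisson (G : ℂ → ℂ) {x : ℝ} (hx : 0 < x) (y t : ℝ) :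
    (halfPlanePoisson x (y - t) : ℂ) * (G (t * Complex.I) - G (x + y * Complex.I)) =
      -(x / Real.pi : ℂ) * (dslope G (x + y * Complex.I) (t * Complex.I) /
        (t * Complex.I + (starRingEnd ℂ) (x + y * Complex.I))) := by
  have hne : (t * Complex.I : ℂ) ≠ x + y * Complex.I := fun h => by
    have := congrArg Complex.re h
    simp at this
    exact hx.ne this
  have hpos : (0 : ℝ) < (y - t) ^ 2 + x ^ 2 := by positivity
  have hprod : (t * Complex.I - (x + y * Complex.I)) *
      (t * Complex.I + (starRingEnd ℂ) (x + y * Complex.I)) =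
        -(((y - t) ^ 2 + x ^ 2 : ℝ) : ℂ) := by
    simp only [map_add, map_mul, Complex.conj_ofReal, Complex.conj_I]
    push_cast
    linear_combination ((t : ℂ) - y) ^ 2 * Complex.I_sq
  rw [dslope_of_ne _ hne, slope_def_field, div_div, hprod, halfPlanePoisson]
  have hpi : (Real.pi : ℂ) ≠ 0 := by exact_mod_cast Real.pi_ne_zero
  have hpos' : (((y - t) ^ 2 + x ^ 2 : ℝ) : ℂ) ≠ 0 := by exact_mod_cast hpos.ne'
  rw [Complex.ofReal_mul, Complex.ofReal_div, Complex.ofReal_inv]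
  field_simp

/-- The Poisson formula for functions that are analytic up to the boundary. -/
theorem poissonIntegral_of_differentiableOn {G : ℂ → ℂ}
    (hG : DifferentiableOn ℂ G {z | 0 ≤ z.re}) {C : ℝ} (hC : ∀ z : ℂ, 0 ≤ z.re → ‖G z‖ ≤ C)
    {x : ℝ} (hx : 0 < x) (y : ℝ) :
    poissonIntegral x y (fun t => G (t * Complex.I)) = G (x + y * Complex.I) := by
  set w₀ : ℂ := x + y * Complex.I with hw₀
  have hre : w₀.re = x := by simp [hw₀]
  have him : w₀.im = y := by simp [hw₀]
  have hcont : Continuous fun t : ℝ => G (t * Complex.I) :=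
    hG.continuousOn.comp_continuous (by fun_prop) fun t => by simp
  have hb : ∀ t : ℝ, ‖G (t * Complex.I)‖ ≤ C := fun t => hC _ (by simp)
  have hi1 := integrable_halfPlanePoisson_sub_mul hx y hcont.aestronglyMeasurable
    (Eventually.of_forall hb)
  have hi2 : Integrable fun s => (halfPlanePoisson x (y - s) : ℂ) * G w₀ :=
    integrable_halfPlanePoisson_sub_mul hx y aestronglyMeasurable_const
      (Eventually.of_forall fun _ => le_rfl)
  have hlim := intervalIntegral_tendsto_integral (hi1.sub hi2) (l := atTop)
    (a := fun R : ℝ => y - R) (b := fun R : ℝ => y + R)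
    (tendsto_atBot_add_const_left atTop y tendsto_neg_atTop_atBot) (tendsto_atTop_add_const_left _ _ tendsto_id)
  have hzero : Tendsto (fun R : ℝ => ∫ s in (y - R)..(y + R),
      ((halfPlanePoisson x (y - s) : ℂ) * G (s * Complex.I) -
        (halfPlanePoisson x (y - s) : ℂ) * G w₀)) atTop (𝓝 0) := by
    refine squeeze_zero_norm' (a := fun R : ℝ =>
      ‖(x / Real.pi : ℂ)‖ * (2 * C * (4 * R⁻¹ + 2 * x * (R⁻¹ * R⁻¹)))) ?_ ?_
    · filter_upwards [eventually_gt_atTop 0] with R hR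
      simp only [← mul_sub, hw₀, dslope_div_eq_halfPlanePoisson G hx]
      rw [intervalIntegral.integral_const_mul, norm_mul, norm_neg]
      gcongr
      have := norm_intervalIntegral_dslope_div_le hG hC (w₀ := w₀) (by rwa [hre]) hR
      rw [hre, him] at this
      refine this.trans_eq ?_
      field_simp
    · have h := tendsto_inv_atTop_zero (𝕜 := ℝ)
      simpa using (((h.const_mul 4).add ((h.mul h).const_mul (2 * x))).const_mul (2 * C)).const_mul
        ‖(x / Real.pi : ℂ)‖
  have h0 := tendsto_nhds_unique hlim hzero
  simp only [Pi.sub_apply] at h0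
  rw [integral_sub hi1 hi2, sub_eq_zero] at h0
  exact h0.trans (poissonIntegral_const hx y (G w₀))

/-- The Poisson formula for a function in `H^∞` with given boundary values. -/
theorem IsHardyInf.poissonIntegral_eq {F : ℂ → ℂ} (hF : IsHardyInf F) {g : ℝ → ℂ}
    (hg : ∀ᵐ y : ℝ, Tendsto (fun x : ℝ => F ((x : ℂ) + (y : ℂ) * Complex.I)) (𝓝[>] 0) (𝓝 (g y)))
    {x : ℝ} (hx : 0 < x) (y : ℝ) :
    poissonIntegral x y g = F (x + y * Complex.I) := by
  obtain ⟨hd, C, hC⟩ := hF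
  -- The translates `F (ε + ·)` are analytic up to the imaginary axis; dominated convergence handles
  -- `ε → 0+`.
  have hmaps : ∀ {ε : ℝ}, 0 < ε → ∀ z : ℂ, 0 ≤ z.re → 0 < ((ε : ℂ) + z).re := fun hε z hz => by
    simp only [Complex.add_re, Complex.ofReal_re]; linarith
  have hG : ∀ {ε : ℝ}, 0 < ε → DifferentiableOn ℂ (fun z => F (ε + z)) {z | 0 ≤ z.re} :=
    fun hε => hd.comp (by fun_prop) fun z hz => hmaps hε z hz
  have heq : ∀ ε : ℝ, 0 < ε → poissonIntegral x y (fun t => F (ε + t * Complex.I)) =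
      F (ε + (x + y * Complex.I)) := fun ε hε =>
    poissonIntegral_of_differentiableOn (G := fun z => F (ε + z)) (hG hε)
      (fun z hz => hC _ (hmaps hε z hz)) hx y
  have hl : Tendsto (fun ε : ℝ => poissonIntegral x y (fun t => F (ε + t * Complex.I)))
      (𝓝[>] 0) (𝓝 (poissonIntegral x y g)) := by
    refine tendsto_integral_filter_of_dominated_convergence
      (fun s => halfPlanePoisson x (y - s) * C) ?_ ?_
      (((integrable_halfPlanePoisson hx).comp_sub_left y).mul_const C) ?_
    · filter_upwards [self_mem_nhdsWithin] with ε hε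
      have hc : Continuous fun t : ℝ => F (ε + t * Complex.I) :=
        (hG hε).continuousOn.comp_continuous (f := fun t : ℝ => (t * Complex.I : ℂ))
          (by fun_prop) fun t => by simp
      have hP := continuous_halfPlanePoisson hx
      exact (Continuous.mul (by fun_prop) hc).aestronglyMeasurable
    · filter_upwards [self_mem_nhdsWithin] with ε hε
      refine Eventually.of_forall fun s => ?_
      rw [norm_mul, Complex.norm_real, Real.norm_of_nonneg (halfPlanePoisson_nonneg hx _)]
      exact mul_le_mul_of_nonneg_left (hC _ (hmaps hε _ (by simp))) (halfPlanePoisson_nonneg hx _)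
    · filter_upwards [hg] with s hs using hs.const_mul _
  have hr : Tendsto (fun ε : ℝ => F (ε + (x + y * Complex.I))) (𝓝[>] 0)
      (𝓝 (F (x + y * Complex.I))) := by
    have hc : ContinuousAt F (x + y * Complex.I) :=
      (hd.differentiableAt ((isOpen_lt continuous_const Complex.continuous_re).mem_nhds
        (by simpa using hx))).continuousAt
    have h1 : Tendsto (fun ε : ℝ => (ε : ℂ) + (x + y * Complex.I)) (𝓝[>] 0)
        (𝓝 (x + y * Complex.I)) := by
      have : Tendsto (fun ε : ℝ => (ε : ℂ) + (x + y * Complex.I)) (𝓝 0)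
          (𝓝 (((0 : ℝ) : ℂ) + (x + y * Complex.I))) :=
        (Continuous.tendsto (by fun_prop) 0)
      simpa using this.mono_left nhdsWithin_le_nhds
    exact hc.tendsto.comp h1
  refine tendsto_nhds_unique hl (hr.congr' ?_)
  filter_upwards [self_mem_nhdsWithin] with ε hε using (heq ε hε).symm

/-! ### Poisson evaluations as means on `L^∞(ℝ)` -/

theorem ae_norm_le_norm_LInf (φ : LInf) : ∀ᵐ t : ℝ, ‖φ t‖ ≤ ‖φ‖ := by
  filter_upwards [ae_le_eLpNormEssSup (f := (φ : ℝ → ℂ)) (μ := volume)] with t ht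
  have hfin := Lp.eLpNorm_ne_top φ
  rw [eLpNorm_exponent_top] at hfin
  rw [Lp.norm_def, eLpNorm_exponent_top, ← toReal_enorm]
  exact ENNReal.toReal_mono hfin ht

theorem norm_LInf_le_of_ae_bound {φ : LInf} {C : ℝ} (hC : 0 ≤ C) (h : ∀ᵐ t : ℝ, ‖φ t‖ ≤ C) :
    ‖φ‖ ≤ C := by
  rw [Lp.norm_def, eLpNorm_exponent_top]
  exact ENNReal.toReal_le_of_le_ofReal hC (eLpNormEssSup_le_of_ae_bound h)

theorem coeFn_oneLInf : oneLInf =ᵐ[volume] fun _ => (1 : ℂ) :=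
  MemLp.coeFn_toLp _

theorem coeFn_convLInf {f : ℝ → ℝ} (hf : Integrable f) (φ : LInf) :
    convLInf f hf φ =ᵐ[volume] f ⋆[ContinuousLinearMap.lsmul ℝ ℝ, volume] (φ : ℝ → ℂ) :=
  MemLp.coeFn_toLp _

theorem integrable_halfPlanePoisson_mul_LInf {x : ℝ} (hx : 0 < x) (y : ℝ) (φ : LInf) :
    Integrable fun s => (halfPlanePoisson x (y - s) : ℂ) * φ s :=
  integrable_halfPlanePoisson_sub_mul hx y (Lp.aestronglyMeasurable φ) (ae_norm_le_norm_LInf φ)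

theorem poissonIntegral_congr_ae (x y : ℝ) {g h : ℝ → ℂ} (hgh : g =ᵐ[volume] h) :
    poissonIntegral x y g = poissonIntegral x y h := by
  refine integral_congr_ae ?_
  filter_upwards [hgh] with s hs
  rw [hs]

/-- Evaluation at `x + iy` of the Poisson extension, as a functional on `L^∞(ℝ)`. -/
noncomputable def poissonFunctional (x y : ℝ) (hx : 0 < x) : StrongDual ℂ LInf :=
  LinearMap.mkContinuous
    { toFun := fun φ => poissonIntegral x y φ
      map_add' := fun φ ψ => by
        rw [poissonIntegral_congr_ae x y (Lp.coeFn_add φ ψ)]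
        simp only [poissonIntegral, Pi.add_apply, mul_add]
        exact integral_add (integrable_halfPlanePoisson_mul_LInf hx y φ)
          (integrable_halfPlanePoisson_mul_LInf hx y ψ)
      map_smul' := fun c φ => by
        rw [poissonIntegral_congr_ae x y (Lp.coeFn_smul c φ)]
        simp only [poissonIntegral, Pi.smul_apply, smul_eq_mul, mul_left_comm _ c,
          integral_const_mul, RingHom.id_apply] }
    1 fun φ => by
      rw [one_mul]
      exact norm_poissonIntegral_le hx y (ae_norm_le_norm_LInf φ)

theorem poissonFunctional_apply {x : ℝ} (y : ℝ) (hx : 0 < x) (φ : LInf) :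
    poissonFunctional x y hx φ = poissonIntegral x y φ := rfl

theorem norm_poissonFunctional_le {x : ℝ} (y : ℝ) (hx : 0 < x) :
    ‖poissonFunctional x y hx‖ ≤ 1 :=
  LinearMap.mkContinuous_norm_le _ zero_le_one _

theorem isMean_poissonFunctional {x : ℝ} (y : ℝ) (hx : 0 < x) :
    IsMean (poissonFunctional x y hx) := by
  refine ⟨fun φ hφ => ?_, ?_⟩
  · rw [poissonFunctional_apply]
    refine integral_nonneg_of_ae ?_
    filter_upwards [hφ] with s hs
    exact mul_nonneg (by exact_mod_cast halfPlanePoisson_nonneg hx _) hs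
  · rw [poissonFunctional_apply, poissonIntegral_congr_ae x y coeFn_oneLInf]
    exact poissonIntegral_const hx y 1

theorem poissonFunctional_convLInf {x : ℝ} (y : ℝ) (hx : 0 < x) {f : ℝ → ℝ} (hf : Integrable f)
    (φ : LInf) :
    poissonFunctional x y hx (convLInf f hf φ) = ∫ t, (f t : ℂ) * poissonIntegral x (y - t) φ := by
  rw [poissonFunctional_apply, poissonIntegral_congr_ae x y (coeFn_convLInf hf φ)]
  exact poissonIntegral_convolution hx y hf (Lp.aestronglyMeasurable φ) (ae_norm_le_norm_LInf φ)

theorem continuous_poissonIntegral {x : ℝ} (hx : 0 < x) (φ : LInf) :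
    Continuous fun y => poissonIntegral x y φ := by
  refine (LipschitzWith.of_dist_le_mul (K := (x⁻¹ * ‖φ‖).toNNReal) fun y z => ?_).continuous
  rw [Real.coe_toNNReal _ (by positivity), dist_eq_norm, Real.dist_eq]
  refine (norm_poissonIntegral_sub_le hx y z (Lp.aestronglyMeasurable φ)
    (ae_norm_le_norm_LInf φ)).trans_eq ?_
  ring

/-- The Poisson functionals at points going to infinity horizontally are asymptotically
topologically invariant. -/
theorem tendsto_poissonFunctional_convLInf_sub {x y : ℕ → ℝ} (hx : ∀ n, 0 < x n)
    (hlim : Tendsto x atTop atTop) {f : ℝ → ℝ} (hf : IsProbDensity f) (φ : LInf) :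
    Tendsto (fun n => poissonFunctional (x n) (y n) (hx n) (convLInf f hf.1 φ) -
      poissonFunctional (x n) (y n) (hx n) φ) atTop (𝓝 0) := by
  have hmeas : ∀ n, AEStronglyMeasurable fun t => poissonIntegral (x n) (y n - t) φ := fun n =>
    ((continuous_poissonIntegral (hx n) φ).comp (by fun_prop)).aestronglyMeasurable
  have hbd : ∀ n t, ‖poissonIntegral (x n) t φ‖ ≤ ‖φ‖ := fun n t =>
    norm_poissonIntegral_le (hx n) t (ae_norm_le_norm_LInf φ)
  have heq : ∀ n, poissonFunctional (x n) (y n) (hx n) (convLInf f hf.1 φ) -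
      poissonFunctional (x n) (y n) (hx n) φ =
      ∫ t, (f t : ℂ) * (poissonIntegral (x n) (y n - t) φ - poissonIntegral (x n) (y n) φ) := by
    intro n
    have h1 : ∫ t, (f t : ℂ) * poissonIntegral (x n) (y n) φ = poissonIntegral (x n) (y n) φ := by
      rw [integral_mul_const, integral_complex_ofReal, hf.2.2, Complex.ofReal_one, one_mul]
    have hi1 : Integrable fun t => (f t : ℂ) * poissonIntegral (x n) (y n - t) φ :=
      hf.1.ofReal.mul_bdd (hmeas n) (Eventually.of_forall fun t => hbd n _)
    have hi2 : Integrable fun t => (f t : ℂ) * poissonIntegral (x n) (y n) φ :=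
      hf.1.ofReal.mul_const _
    simp only [mul_sub]
    rw [poissonFunctional_convLInf, poissonFunctional_apply, integral_sub hi1 hi2, h1]
  simp only [heq]
  have hzero : (0 : ℂ) = ∫ _ : ℝ, (0 : ℂ) := by simp
  rw [hzero]
  refine tendsto_integral_of_dominated_convergence (fun t => |f t| * (‖φ‖ + ‖φ‖))
    (fun n => ?_) (hf.1.abs.mul_const _) (fun n => Eventually.of_forall fun t => ?_)
    (Eventually.of_forall fun t => ?_)
  · exact hf.1.ofReal.aestronglyMeasurable.mul ((hmeas n).sub aestronglyMeasurable_const)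
  · rw [norm_mul, Complex.norm_real, Real.norm_eq_abs]
    exact mul_le_mul_of_nonneg_left
      ((norm_sub_le _ _).trans (add_le_add (hbd n _) (hbd n _))) (abs_nonneg _)
  · have h0 : Tendsto (fun n => poissonIntegral (x n) (y n - t) φ -
        poissonIntegral (x n) (y n) φ) atTop (𝓝 0) := by
      refine squeeze_zero_norm (a := fun n => |t| * ‖φ‖ * (x n)⁻¹) (fun n => ?_) ?_
      · refine (norm_poissonIntegral_sub_le (hx n) _ _ (Lp.aestronglyMeasurable φ)
          (ae_norm_le_norm_LInf φ)).trans_eq ?_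
        rw [sub_sub_cancel_left, abs_neg]
        ring
      · simpa using (tendsto_inv_atTop_zero.comp hlim).const_mul (|t| * ‖φ‖)
    simpa using h0.const_mul (f t : ℂ)

/-! ### Invariant means as limits, and the Poisson criterion -/

/-- Banach-Alaoglu along an ultrafilter: a bounded sequence of functionals converges pointwise. -/
theorem exists_tendsto_of_norm_le {E : Type*} [NormedAddCommGroup E] [NormedSpace ℂ E]
    (u : Ultrafilter ℕ) (Φ : ℕ → StrongDual ℂ E) {C : ℝ} (hΦ : ∀ n, ‖Φ n‖ ≤ C) :
    ∃ Ψ : StrongDual ℂ E, ∀ v, Tendsto (fun n => Φ n v) u (𝓝 (Ψ v)) := by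
  have hc := WeakDual.isCompact_closedBall (𝕜 := ℂ) (E := E) 0 C
  obtain ⟨Ψ, -, hΨ⟩ := hc.ultrafilter_le_nhds (u.map fun n => StrongDual.toWeakDual (Φ n)) (by
    rw [le_principal_iff]
    exact mem_map.2 (univ_mem' fun n => by simpa using hΦ n))
  refine ⟨WeakDual.toStrongDual Ψ, fun v => ?_⟩
  have hΨ' : Tendsto (fun n => StrongDual.toWeakDual (Φ n)) u (𝓝 Ψ) := hΨ
  exact ((WeakDual.eval_continuous v).tendsto Ψ).comp hΨ'

theorem exists_isTopInvariantMean_tendsto {x y : ℕ → ℝ} (hx : ∀ n, 0 < x n)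
    (hlim : Tendsto x atTop atTop) (u : Ultrafilter ℕ) (hu : (u : Filter ℕ) ≤ atTop) :
    ∃ Φ : StrongDual ℂ LInf, IsTopInvariantMean Φ ∧
      ∀ φ : LInf, Tendsto (fun n => poissonIntegral (x n) (y n) φ) u (𝓝 (Φ φ)) := by
  obtain ⟨Φ, hΦ⟩ := exists_tendsto_of_norm_le u (fun n => poissonFunctional (x n) (y n) (hx n))
    fun n => norm_poissonFunctional_le (y n) (hx n)
  refine ⟨Φ, ⟨⟨fun φ hφ => ?_, ?_⟩, fun f hf φ => ?_⟩, hΦ⟩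
  · exact ge_of_tendsto' (hΦ φ) fun n => (isMean_poissonFunctional (y n) (hx n)).1 φ hφ
  · refine tendsto_nhds_unique (hΦ oneLInf) ?_
    simp only [(isMean_poissonFunctional _ (hx _)).2]
    exact tendsto_const_nhds
  · exact sub_eq_zero.1 (tendsto_nhds_unique ((hΦ _).sub (hΦ φ))
      ((tendsto_poissonFunctional_convLInf_sub hx hlim hf φ).mono_left hu))

/-- The Poisson integrals of an almost convergent function converge uniformly. -/
theorem AlmostConvergesTo.tendsto_poissonIntegral {φ : LInf} {α : ℂ}
    (h : AlmostConvergesTo φ α) :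
    TendstoUniformly (fun x y => poissonIntegral x y φ) (fun _ => α) atTop := by
  rw [Metric.tendstoUniformly_iff]
  intro ε hε
  by_contra hcon
  rw [eventually_atTop] at hcon
  push Not at hcon
  -- The bound `n + 1` forces both `x n > 0` and `x n → ∞`.
  choose x hx y hy using fun n : ℕ => hcon (n + 1)
  have hpos : ∀ n, 0 < x n := fun n => lt_of_lt_of_le (by positivity) (hx n)
  have hlim : Tendsto x atTop atTop :=
    tendsto_atTop_mono (fun n => (le_add_of_nonneg_right zero_le_one).trans (hx n))
      tendsto_natCast_atTop_atTop
  obtain ⟨Φ, hΦ, hΦlim⟩ := exists_isTopInvariantMean_tendsto (y := y) hpos hlim (hyperfilter ℕ)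
    Nat.hyperfilter_le_atTop
  have hd := ge_of_tendsto' (tendsto_const_nhds.dist (hΦlim φ)) hy
  rw [h Φ hΦ, dist_self] at hd
  exact absurd hd (not_le.2 hε)

theorem IsTopInvariantMean.eq_of_tendsto_poissonIntegral {Φ : StrongDual ℂ LInf}
    (hΦ : IsTopInvariantMean Φ) {φ : LInf} {α : ℂ}
    (h : TendstoUniformly (fun x y => poissonIntegral x y φ) (fun _ => α) atTop) : Φ φ = α := by
  rw [Metric.tendstoUniformly_iff] at h
  have hle : ∀ ε > 0, ‖Φ φ - α‖ ≤ ‖Φ‖ * ε := by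
    intro ε hε
    obtain ⟨x, hxε, hx⟩ := ((h ε hε).and (eventually_gt_atTop 0)).exists
    have hfP := isProbDensity_halfPlanePoisson hx
    have heq : Φ φ - α = Φ (convLInf (halfPlanePoisson x) hfP.1 φ - α • oneLInf) := by
      rw [map_sub, map_smul, hΦ.2 _ hfP, hΦ.1.2, smul_eq_mul, mul_one]
    rw [heq]
    refine (Φ.le_opNorm _).trans (mul_le_mul_of_nonneg_left ?_ (norm_nonneg _))
    refine norm_LInf_le_of_ae_bound hε.le ?_
    filter_upwards [coeFn_convLInf hfP.1 φ, coeFn_oneLInf,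
      Lp.coeFn_sub (convLInf (halfPlanePoisson x) hfP.1 φ) (α • oneLInf),
      Lp.coeFn_smul α oneLInf] with y h1 h2 h3 h4
    have h5 : (halfPlanePoisson x ⋆[ContinuousLinearMap.lsmul ℝ ℝ, volume] (φ : ℝ → ℂ)) y =
        poissonIntegral x y φ := by
      rw [convolution_def, poissonIntegral,
        ← integral_sub_left_eq_self (fun s => (halfPlanePoisson x (y - s) : ℂ) * φ s) _ y]
      simp only [sub_sub_cancel, ContinuousLinearMap.lsmul_apply, Complex.real_smul]
    rw [h3, Pi.sub_apply, h4, Pi.smul_apply, h1, h2, h5, smul_eq_mul, mul_one, ← dist_eq_norm,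
      dist_comm]
    exact (hxε y).le
  have hlim : Tendsto (fun ε : ℝ => ‖Φ‖ * ε) (𝓝[>] 0) (𝓝 0) := by
    have : Tendsto (fun ε : ℝ => ‖Φ‖ * ε) (𝓝 0) (𝓝 (‖Φ‖ * 0)) := tendsto_id.const_mul _
    rw [mul_zero] at this
    exact this.mono_left nhdsWithin_le_nhds
  have h0 : ‖Φ φ - α‖ ≤ 0 :=
    ge_of_tendsto hlim (by filter_upwards [self_mem_nhdsWithin] with ε hε using hle ε hε)
  exact sub_eq_zero.1 (norm_le_zero_iff.1 h0)

theorem IsHardyInf.mul {F G : ℂ → ℂ} (hF : IsHardyInf F) (hG : IsHardyInf G) :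
    IsHardyInf (F * G) := by
  obtain ⟨hFd, C, hC⟩ := hF
  obtain ⟨hGd, D, hD⟩ := hG
  refine ⟨hFd.mul hGd, C * D, fun z hz => ?_⟩
  rw [Pi.mul_apply, norm_mul]
  exact mul_le_mul (hC z hz) (hD z hz) (norm_nonneg _) ((norm_nonneg _).trans (hC z hz))

theorem corollary4p1 (φ ψ : LInf) (hφ : φ ∈ HInfBoundary) (hψ : ψ ∈ HInfBoundary)
    (α β : ℂ) (hα : AlmostConvergesTo φ α) (hβ : AlmostConvergesTo ψ β) :
    AlmostConvergesTo (mulLInf φ ψ) (α * β) := by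
  obtain ⟨F, hF, hFφ⟩ := hφ
  obtain ⟨G, hG, hGψ⟩ := hψ
  intro Φ hΦ
  refine hΦ.eq_of_tendsto_poissonIntegral ?_
  have hcoe : mulLInf φ ψ =ᵐ[volume] (φ : ℝ → ℂ) * (ψ : ℝ → ℂ) := MemLp.coeFn_toLp _
  have hFG : ∀ᵐ y : ℝ, Tendsto (fun x : ℝ => (F * G) ((x : ℂ) + (y : ℂ) * Complex.I)) (𝓝[>] 0)
      (𝓝 (mulLInf φ ψ y)) := by
    filter_upwards [hFφ, hGψ, hcoe] with y h1 h2 h3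
    rw [h3]
    exact h1.mul h2
  -- Uniform convergence to a constant is ordinary convergence along `atTop ×ˢ ⊤`, where the product
  -- rule for limits applies.
  have hmul := (tendsto_prod_top_iff.2 hα.tendsto_poissonIntegral).mul
    (tendsto_prod_top_iff.2 hβ.tendsto_poissonIntegral)
  refine tendsto_prod_top_iff.1 (hmul.congr' ?_)
  filter_upwards [(eventually_gt_atTop (0 : ℝ)).prod_inl _] with p hp
  change poissonIntegral p.1 p.2 φ * poissonIntegral p.1 p.2 ψ =
    poissonIntegral p.1 p.2 (mulLInf φ ψ)
  rw [hF.poissonIntegral_eq hFφ hp, hG.poissonIntegral_eq hGψ hp,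
    (hF.mul hG).poissonIntegral_eq hFG hp, Pi.mul_apply]
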